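/- Let $F$ be a probability measure on $\mathbb R^2$ with continuous margins, i.e. $F(\{r\}\times\mathbb R)=F(\mathbb R\times\{r\})=0$ for all $r\in\mathbb R$, and with $\int (x^2+y^2)\,dF(x,y)<\infty$. For $\lambda>0$ let $$\Psi(\lambda,F)=e^{-\lambda}\sum_{k=0}^\infty\frac{\lambda^k}{k!}F^{*k},\qquad F^{*0}=\delta_{(0,0)},$$ be the compound Poisson distribution with intensity $\lambda$ and jump distribution $F$, and let $$\Sigma=\begin{pmatrix}\int x^2\,dF(x,y)&\int xy\,dF(x,y)\\ \int xy\,dF(x,y)&\int y^2\,dF(x,y)\end{pmatrix}.$$ A copula is a probability measure on $\mathbb R^2$ both of whose margins are uniform on $[0,1]$; write $H(x,y)=H((-\infty,x]\times(-\infty,y])$ for the distribution function of a probability measure $H$ on $\mathbb R^2$, and $H_1,H_2$ for the distribution functions of its margins. A copula $C$ is called a copula of $H$ if $H(x,y)=C(H_1(x),H_2(y))$ for all $x,y\in\mathbb R$. Then $\Sigma$ is positive semidefinite, the normal distribution $N(0,\Sigma)$ has continuous margins, and it has exactly one copula, $\mathcal T N(0,\Sigma)$ (the Gaussian copula). For every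 $\lambda>0$ the distribution $\Psi(\lambda,F)$ has at least one copula, and for every choice of a copula $C_\lambda$ of $\Psi(\lambda,F)$, $\lambda>0$, $$\sup_{0\le u,v\le 1}\bigl|C_\lambda(u,v)-(\mathcal T N(0,\Sigma))(u,v)\bigr|\longrightarrow 0,\qquad \lambda\to\infty.$$ -/

import Mathlib

open MeasureTheory ProbabilityTheory Filter Topology Set

/-- The plane `ℝ²`. A bivariate distribution is a probability measure on it; the two coordinates
of `x : Plane` are `x 0` and `x 1`. -/
abbrev Plane : Type := EuclideanSpace ℝ (Fin 2)

/-- The (joint) distribution function `F(x, y) = F((-∞, x] × (-∞, y])`. -/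
noncomputable def jointCdf (F : Measure Plane) (x y : ℝ) : ℝ :=
  F.real {p : Plane | p 0 ≤ x ∧ p 1 ≤ y}

/-- The distribution function of the `j`-th margin of `F`. -/
noncomputable def marginCdf (F : Measure Plane) (j : Fin 2) (t : ℝ) : ℝ :=
  F.real {p : Plane | p j ≤ t}

/-- Both margins of `F` are continuous, that is, they have no atoms. -/
def HasContinuousMargins (F : Measure Plane) : Prop :=
  ∀ (j : Fin 2) (r : ℝ), F {p : Plane | p j = r} = 0

/-- A copula: a probability measure on the plane with continuous margins, both of which are
uniform on `[0, 1]`. -/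
structure IsCopula (C : Measure Plane) : Prop where
  isProbabilityMeasure : IsProbabilityMeasure C
  continuousMargins : HasContinuousMargins C
  uniformMargins : ∀ (j : Fin 2) (t : ℝ), 0 ≤ t → t ≤ 1 →
    C {p : Plane | 0 ≤ p j ∧ p j ≤ t} = ENNReal.ofReal t

/-- `C` is a copula of the distribution `F`: it is a copula and
`F(x, y) = C(F₁(x), F₂(y))` for all real `x, y`. -/
def IsCopulaOf (C F : Measure Plane) : Prop :=
  IsCopula C ∧ ∀ x y : ℝ, jointCdf F x y = jointCdf C (marginCdf F 0 x) (marginCdf F 1 y)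

/-- The convolution powers of `F`, with `F^{∗0}` the unit mass at the origin. -/
noncomputable def convPower (F : Measure Plane) : ℕ → Measure Plane
  | 0 => Measure.dirac 0
  | k + 1 => Measure.conv (convPower F k) F

/-- The compound Poisson distribution
`Ψ(lam, F) = e^{-lam} ∑ₖ lam^k / k! F^{∗k}` with intensity `lam` and jump distribution `F`. -/
noncomputable def compoundPoisson (lam : ℝ) (F : Measure Plane) : Measure Plane :=
  Measure.sum fun k : ℕ =>
    ENNReal.ofReal (Real.exp (-lam) * (lam ^ k / (k.factorial : ℝ))) • convPower F k

/-- The matrix of the non-centred second moments of `F`. -/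
noncomputable def secondMomentMatrix (F : Measure Plane) : Matrix (Fin 2) (Fin 2) ℝ :=
  !![∫ p, (p 0) ^ 2 ∂F, ∫ p, p 0 * p 1 ∂F;
     ∫ p, p 0 * p 1 ∂F, ∫ p, (p 1) ^ 2 ∂F]

/-! Increasing affine maps of the coordinates do not change the copulas, so `compoundPoisson lam F`
may be centred and divided by `√lam` (`IsCopulaOf.standardizedCompoundPoisson`). With `a = ⟨p, t⟩`,
the characteristic function becomes the exponential of `∫ lam (e^{ia/√lam} - 1 - ia/√lam) dF`. By
dominated convergence this exponent tends to `-½ ∫ a² dF = -½ tᵀΣt`, and Lévy's continuity theorem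
gives weak convergence to `N(0, Σ)`.

The margins of `F` have no atom at `0`, so `Σ` has a positive diagonal and the Gaussian margins are
continuous. Hence the Gaussian copula is unique, and the joint and marginal distribution functions
converge pointwise. Copulas are 1-Lipschitz in each variable, so this convergence passes to any
choice of copulas, and uniformly (`tendstoUniformlyOn_copula`).

For fixed `lam`, the event of no jump creates an atom at the origin. Spreading it over an interval
by an independent uniform variable reduces existence to the continuous case
(`exists_isCopulaOf_of_atom_zero`). -/

lemma measurable_plane_apply (j : Fin 2) : Measurable fun p : Plane => p j := by fun_prop

lemma measurableSet_margin_le (j : Fin 2) (t : ℝ) : MeasurableSet {p : Plane | p j ≤ t} :=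
  measurable_plane_apply j measurableSet_Iic

lemma measurableSet_margin_eq (j : Fin 2) (t : ℝ) : MeasurableSet {p : Plane | p j = t} :=
  measurable_plane_apply j (measurableSet_singleton t)

lemma measurableSet_quadrant (x y : ℝ) : MeasurableSet {p : Plane | p 0 ≤ x ∧ p 1 ≤ y} :=
  (measurableSet_margin_le 0 x).inter (measurableSet_margin_le 1 y)

/-! ### Distribution functions -/

lemma marginCdf_eq_cdf (H : Measure Plane) [IsProbabilityMeasure H] (j : Fin 2) (t : ℝ) :
    marginCdf H j t = cdf (H.map fun p => p j) t := by
  have := Measure.isProbabilityMeasure_map (μ := H) (measurable_plane_apply j).aemeasurable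
  rw [cdf_eq_real, map_measureReal_apply (measurable_plane_apply j) measurableSet_Iic]
  rfl

lemma marginCdf_mono (H : Measure Plane) [IsProbabilityMeasure H] (j : Fin 2) :
    Monotone (marginCdf H j) := fun _ _ hst =>
  measureReal_mono fun _ hp => le_trans hp hst

lemma measurable_marginCdf (H : Measure Plane) [IsProbabilityMeasure H] (j : Fin 2) :
    Measurable (marginCdf H j) := (marginCdf_mono H j).measurable

lemma marginCdf_nonneg (H : Measure Plane) (j : Fin 2) (t : ℝ) : 0 ≤ marginCdf H j t :=
  measureReal_nonneg

lemma marginCdf_le_one (H : Measure Plane) [IsProbabilityMeasure H] (j : Fin 2) (t : ℝ) :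
    marginCdf H j t ≤ 1 := measureReal_le_one

lemma marginCdf_mem_Icc (H : Measure Plane) [IsProbabilityMeasure H] (j : Fin 2) (t : ℝ) :
    marginCdf H j t ∈ Icc (0 : ℝ) 1 := ⟨marginCdf_nonneg H j t, marginCdf_le_one H j t⟩

lemma HasContinuousMargins.continuous_marginCdf {H : Measure Plane} [IsProbabilityMeasure H]
    (hH : HasContinuousMargins H) (j : Fin 2) : Continuous (marginCdf H j) := by
  have := Measure.isProbabilityMeasure_map (μ := H) (measurable_plane_apply j).aemeasurable
  have hfun : marginCdf H j = cdf (H.map fun p => p j) := funext (marginCdf_eq_cdf H j)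
  rw [hfun, continuous_iff_continuousAt]
  intro t
  rw [(monotone_cdf _).continuousAt_iff_leftLim_eq_rightLim, StieltjesFunction.rightLim_eq]
  have h0 : (cdf (H.map fun p => p j)).measure {t} = 0 := by
    rw [measure_cdf, Measure.map_apply (measurable_plane_apply j) (measurableSet_singleton t)]
    exact hH j t
  rw [StieltjesFunction.measure_singleton, ENNReal.ofReal_eq_zero] at h0
  exact le_antisymm ((monotone_cdf _).leftLim_le le_rfl) (by linarith)

lemma HasContinuousMargins.exists_marginCdf_eq {H : Measure Plane} [IsProbabilityMeasure H]
    (hH : HasContinuousMargins H) (j : Fin 2) {u : ℝ} (hu : u ∈ Ioo (0 : ℝ) 1) :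
    ∃ x, marginCdf H j x = u := by
  have hfun : marginCdf H j = cdf (H.map fun p => p j) := funext (marginCdf_eq_cdf H j)
  have hbot : Tendsto (marginCdf H j) atBot (𝓝 0) := hfun ▸ tendsto_cdf_atBot _
  have htop : Tendsto (marginCdf H j) atTop (𝓝 1) := hfun ▸ tendsto_cdf_atTop _
  obtain ⟨a, ha⟩ := (hbot.eventually (gt_mem_nhds hu.1)).exists
  obtain ⟨b, hb⟩ := (htop.eventually (lt_mem_nhds hu.2)).exists
  exact mem_range_of_exists_le_of_exists_ge (hH.continuous_marginCdf j) ⟨a, ha.le⟩ ⟨b, hb.le⟩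

/-- A bivariate distribution is determined by its distribution function. -/
lemma measure_ext_of_jointCdf {μ ν : Measure Plane} [IsFiniteMeasure μ] [IsFiniteMeasure ν]
    (h : ∀ x y, jointCdf μ x y = jointCdf ν x y) : μ = ν := by
  have hq (x y : ℝ) : μ {p : Plane | p 0 ≤ x ∧ p 1 ≤ y} = ν {p : Plane | p 0 ≤ x ∧ p 1 ≤ y} :=
    (measureReal_eq_measureReal_iff).1 (h x y)
  -- Uniqueness on the line is applied one coordinate at a time: half-lines are upgraded to Borel
  -- sets first in coordinate 0, then in coordinate 1.
  have h1 (y : ℝ) : (μ.restrict {p | p 1 ≤ y}).map (fun p => p 0)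
      = (ν.restrict {p | p 1 ≤ y}).map (fun p => p 0) := by
    refine Measure.ext_of_Iic _ _ fun x => ?_
    rw [Measure.map_apply (measurable_plane_apply 0) measurableSet_Iic,
      Measure.map_apply (measurable_plane_apply 0) measurableSet_Iic,
      Measure.restrict_apply (measurable_plane_apply 0 measurableSet_Iic),
      Measure.restrict_apply (measurable_plane_apply 0 measurableSet_Iic)]
    exact hq x y
  have h2 {s : Set ℝ} (hs : MeasurableSet s) :
      (μ.restrict {p | p 0 ∈ s}).map (fun p => p 1)
        = (ν.restrict {p | p 0 ∈ s}).map (fun p => p 1) := by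
    refine Measure.ext_of_Iic _ _ fun y => ?_
    have := congrArg (fun m => m s) (h1 y)
    simp only [Measure.map_apply (measurable_plane_apply 0) hs] at this
    rw [Measure.restrict_apply (measurable_plane_apply 0 hs),
      Measure.restrict_apply (measurable_plane_apply 0 hs)] at this
    rw [Measure.map_apply (measurable_plane_apply 1) measurableSet_Iic,
      Measure.map_apply (measurable_plane_apply 1) measurableSet_Iic,
      Measure.restrict_apply (measurable_plane_apply 1 measurableSet_Iic),
      Measure.restrict_apply (measurable_plane_apply 1 measurableSet_Iic), inter_comm]
    exact this
  have he : Measurable fun p : Plane => (p 0, p 1) := by fun_prop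
  have hg : Measurable fun q : ℝ × ℝ => (!₂[q.1, q.2] : Plane) := by
    refine (WithLp.measurable_toLp 2 _).comp (measurable_pi_iff.2 fun i => ?_)
    fin_cases i
    · exact measurable_fst
    · exact measurable_snd
  have hmap : μ.map (fun p : Plane => (p 0, p 1)) = ν.map (fun p : Plane => (p 0, p 1)) := by
    refine Measure.ext_prod fun {s t} hs ht => ?_
    have := congrArg (fun m => m t) (h2 hs)
    simp only [Measure.map_apply (measurable_plane_apply 1) ht] at this
    rw [Measure.restrict_apply (measurable_plane_apply 1 ht),
      Measure.restrict_apply (measurable_plane_apply 1 ht)] at this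
    rw [Measure.map_apply he (hs.prod ht), Measure.map_apply he (hs.prod ht)]
    have hset : (fun p : Plane => (p 0, p 1)) ⁻¹' s ×ˢ t
        = (fun p : Plane => p 1) ⁻¹' t ∩ {p | p 0 ∈ s} := by
      ext p; simp [and_comm]
    rw [hset]
    exact this
  have hid : (fun q : ℝ × ℝ => (!₂[q.1, q.2] : Plane)) ∘ (fun p : Plane => (p 0, p 1)) = id := by
    funext p
    ext i
    fin_cases i <;> simp
  have := congrArg (Measure.map fun q : ℝ × ℝ => (!₂[q.1, q.2] : Plane)) hmap
  rwa [Measure.map_map hg he, Measure.map_map hg he, hid, Measure.map_id, Measure.map_id] at this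

/-- The difference of the two quadrants is covered by a vertical and a horizontal strip. -/
lemma jointCdf_sub_le {H : Measure Plane} [IsProbabilityMeasure H] {x x' y y' : ℝ} (hx : x ≤ x')
    (hy : y ≤ y') :
    jointCdf H x' y' - jointCdf H x y
      ≤ (marginCdf H 0 x' - marginCdf H 0 x) + (marginCdf H 1 y' - marginCdf H 1 y) := by
  have hd (j : Fin 2) {s t : ℝ} (hst : s ≤ t) :
      H.real ({p | p j ≤ t} \ {p | p j ≤ s}) = marginCdf H j t - marginCdf H j s :=
    measureReal_sdiff (fun p hp => le_trans hp hst) (measurableSet_margin_le j s)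
  rw [← hd 0 hx, ← hd 1 hy, sub_le_iff_le_add]
  refine (measureReal_mono (s₂ := ({p : Plane | p 0 ≤ x'} \ {p | p 0 ≤ x} ∪
    {p : Plane | p 1 ≤ y'} \ {p | p 1 ≤ y}) ∪ {p | p 0 ≤ x ∧ p 1 ≤ y}) ?_).trans
      ((measureReal_union_le _ _).trans (add_le_add_left (measureReal_union_le _ _) _))
  intro p hp
  simp only [mem_union, Set.mem_sdiff, mem_ofPred_eq] at hp ⊢
  tauto

lemma jointCdf_mono {H : Measure Plane} [IsProbabilityMeasure H] {x x' y y' : ℝ} (hx : x ≤ x')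
    (hy : y ≤ y') : jointCdf H x y ≤ jointCdf H x' y' :=
  measureReal_mono fun _ hp => ⟨hp.1.trans hx, hp.2.trans hy⟩

/-! ### Copulas -/

namespace IsCopula

variable {C : Measure Plane}

lemma ae_mem_Ioc (hC : IsCopula C) (j : Fin 2) : ∀ᵐ p ∂C, p j ∈ Ioc (0 : ℝ) 1 := by
  have := hC.isProbabilityMeasure
  have h1 : ∀ᵐ p ∂C, 0 ≤ p j ∧ p j ≤ 1 := by
    refine (mem_ae_iff_prob_eq_one (measurable_plane_apply j measurableSet_Icc)).2 ?_
    simpa using! hC.uniformMargins j 1 zero_le_one le_rfl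
  have h0 : ∀ᵐ p ∂C, p j ≠ 0 := by
    rw [ae_iff]
    simpa using hC.continuousMargins j 0
  filter_upwards [h0, h1] with p hp0 hp1
  exact ⟨lt_of_le_of_ne hp1.1 hp0.symm, hp1.2⟩

lemma marginCdf_eq (hC : IsCopula C) (j : Fin 2) {t : ℝ} (ht : t ∈ Icc (0 : ℝ) 1) :
    marginCdf C j t = t := by
  have h : C {p | p j ≤ t} = C {p | 0 ≤ p j ∧ p j ≤ t} := by
    refine measure_congr ?_
    filter_upwards [hC.ae_mem_Ioc j] with p hp
    exact propext ⟨fun h => ⟨hp.1.le, h⟩, fun h => h.2⟩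
  rw [marginCdf, Measure.real, h, hC.uniformMargins j t ht.1 ht.2, ENNReal.toReal_ofReal ht.1]

lemma jointCdf_projIcc (hC : IsCopula C) (x y : ℝ) :
    jointCdf C x y = jointCdf C (max 0 (min x 1)) (max 0 (min y 1)) := by
  -- Strict positivity of `s` matters: a negative `r` is clamped to `0`.
  have key {r s : ℝ} (hs : s ∈ Ioc (0 : ℝ) 1) : s ≤ r ↔ s ≤ max 0 (min r 1) := by
    simp [hs.1.not_ge, hs.2]
  refine congrArg ENNReal.toReal (measure_congr ?_)
  filter_upwards [hC.ae_mem_Ioc 0, hC.ae_mem_Ioc 1] with p h0 h1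
  exact propext (and_congr (key h0) (key h1))

/-- Both values lie between those at the componentwise minimum and maximum, where the strip bound
applies with uniform margins. -/
lemma abs_jointCdf_sub_le (hC : IsCopula C) {u v u' v' : ℝ} (hu : u ∈ Icc (0 : ℝ) 1)
    (hv : v ∈ Icc (0 : ℝ) 1) (hu' : u' ∈ Icc (0 : ℝ) 1) (hv' : v' ∈ Icc (0 : ℝ) 1) :
    |jointCdf C u v - jointCdf C u' v'| ≤ |u - u'| + |v - v'| := by
  have := hC.isProbabilityMeasure
  have hmem {a b : ℝ} (ha : a ∈ Icc (0 : ℝ) 1) (hb : b ∈ Icc (0 : ℝ) 1) :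
      min a b ∈ Icc (0 : ℝ) 1 ∧ max a b ∈ Icc (0 : ℝ) 1 :=
    ⟨⟨le_min ha.1 hb.1, (min_le_left _ _).trans ha.2⟩,
      ⟨ha.1.trans (le_max_left _ _), max_le ha.2 hb.2⟩⟩
  have key := jointCdf_sub_le (H := C) (min_le_max (a := u) (b := u')) (min_le_max (a := v) (b := v'))
  rw [hC.marginCdf_eq 0 (hmem hu hu').1, hC.marginCdf_eq 0 (hmem hu hu').2,
    hC.marginCdf_eq 1 (hmem hv hv').1, hC.marginCdf_eq 1 (hmem hv hv').2, max_sub_min_eq_abs',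
    max_sub_min_eq_abs'] at key
  have h1 := jointCdf_mono (H := C) (min_le_left u u') (min_le_left v v')
  have h2 := jointCdf_mono (H := C) (min_le_right u u') (min_le_right v v')
  have h3 := jointCdf_mono (H := C) (le_max_left u u') (le_max_left v v')
  have h4 := jointCdf_mono (H := C) (le_max_right u u') (le_max_right v v')
  rw [abs_le]
  constructor <;> linarith

end IsCopula

/-- Pointwise convergence of copulas on the open unit square is uniform on the closed one. -/
lemma tendstoUniformlyOn_jointCdf_of_isCopula {ι : Type*} {l : Filter ι} {C : ι → Measure Plane}
    {G : Measure Plane} (hC : ∀ᶠ i in l, IsCopula (C i)) (hG : IsCopula G)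
    (h : ∀ u ∈ Ioo (0 : ℝ) 1, ∀ v ∈ Ioo (0 : ℝ) 1,
      Tendsto (fun i => jointCdf (C i) u v) l (𝓝 (jointCdf G u v))) :
    TendstoUniformlyOn (fun i (p : ℝ × ℝ) => jointCdf (C i) p.1 p.2)
      (fun p : ℝ × ℝ => jointCdf G p.1 p.2) l (Icc 0 1 ×ˢ Icc 0 1) := by
  have hcomp : IsCompact (Icc (0 : ℝ) 1 ×ˢ Icc (0 : ℝ) 1) := isCompact_Icc.prod isCompact_Icc
  rw [← tendstoLocallyUniformlyOn_iff_tendstoUniformlyOn_of_compact hcomp,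
    Metric.tendstoLocallyUniformlyOn_iff]
  rintro ε hε ⟨a, b⟩ ⟨ha, hb⟩
  -- Two distances of `ε / 12` put each coordinate within `ε / 6` of `(u, v)`. The two Lipschitz
  -- bounds then cost `ε / 3` each and the convergence at `(u, v)` costs `ε / 4`, in total less than
  -- `ε`.
  have hnear {x : ℝ} (hx : x ∈ Icc (0 : ℝ) 1) : ∃ y ∈ Ioo (0 : ℝ) 1, |x - y| < ε / 12 := by
    rw [← closure_Ioo (zero_ne_one' ℝ), Metric.mem_closure_iff] at hx
    exact hx _ (by positivity)
  obtain ⟨u, hu, hau⟩ := hnear ha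
  obtain ⟨v, hv, hbv⟩ := hnear hb
  refine ⟨Metric.ball (a, b) (ε / 12) ∩ Icc 0 1 ×ˢ Icc 0 1,
    inter_mem (mem_nhdsWithin_of_mem_nhds (Metric.ball_mem_nhds _ (by positivity)))
      self_mem_nhdsWithin, ?_⟩
  filter_upwards [hC, (Metric.tendsto_nhds.1 (h u hu v hv)) (ε / 4) (by positivity)] with i hCi hi
  rintro ⟨x, y⟩ ⟨hxy, hx, hy⟩
  rw [Metric.mem_ball, Prod.dist_eq, max_lt_iff] at hxy
  have hxu : |x - u| < ε / 6 := by
    have := abs_sub_le x a u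
    have h1 : |x - a| < ε / 12 := hxy.1
    linarith
  have hyv : |y - v| < ε / 6 := by
    have := abs_sub_le y b v
    have h1 : |y - b| < ε / 12 := hxy.2
    linarith
  have h1 := hCi.abs_jointCdf_sub_le hx hy (Ioo_subset_Icc_self hu) (Ioo_subset_Icc_self hv)
  have h2 := hG.abs_jointCdf_sub_le hx hy (Ioo_subset_Icc_self hu) (Ioo_subset_Icc_self hv)
  rw [Real.dist_eq] at hi ⊢
  rw [abs_lt] at hi ⊢
  rw [abs_le] at h1 h2
  constructor <;> linarith

/-- A constant sequence turns the uniform convergence statement into equality on the closed square;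
clamping extends it to the plane. -/
lemma IsCopula.ext_of_jointCdf {C G : Measure Plane} (hC : IsCopula C) (hG : IsCopula G)
    (h : ∀ u ∈ Ioo (0 : ℝ) 1, ∀ v ∈ Ioo (0 : ℝ) 1, jointCdf C u v = jointCdf G u v) : C = G := by
  have := hC.isProbabilityMeasure
  have := hG.isProbabilityMeasure
  have hu := tendstoUniformlyOn_jointCdf_of_isCopula (l := (atTop : Filter ℕ)) (C := fun _ => C)
    (.of_forall fun _ => hC) hG fun u hu v hv => h u hu v hv ▸ tendsto_const_nhds
  have hproj (x : ℝ) : max 0 (min x 1) ∈ Icc (0 : ℝ) 1 := by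
    simp
  refine measure_ext_of_jointCdf fun x y => ?_
  rw [hC.jointCdf_projIcc, hG.jointCdf_projIcc]
  exact tendsto_nhds_unique tendsto_const_nhds
    (hu.tendsto_at (x := (max 0 (min x 1), max 0 (min y 1))) ⟨hproj x, hproj y⟩)

/-- A distribution with continuous margins has at most one copula. -/
lemma IsCopulaOf.unique {C C' H : Measure Plane} [IsProbabilityMeasure H]
    (hH : HasContinuousMargins H) (hC : IsCopulaOf C H) (hC' : IsCopulaOf C' H) : C = C' := by
  refine hC.1.ext_of_jointCdf hC'.1 fun u hu v hv => ?_
  obtain ⟨x, rfl⟩ := hH.exists_marginCdf_eq 0 hu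
  obtain ⟨y, rfl⟩ := hH.exists_marginCdf_eq 1 hv
  rw [← hC.2, ← hC'.2]

/-- Copulas of distributions whose distribution functions converge pointwise to that of a
distribution with continuous margins converge uniformly. -/
lemma tendstoUniformlyOn_copula {ι : Type*} {l : Filter ι} {C H : ι → Measure Plane}
    {G K : Measure Plane} [IsProbabilityMeasure K] (hK : HasContinuousMargins K)
    (hH : ∀ᶠ i in l, IsProbabilityMeasure (H i)) (hC : ∀ᶠ i in l, IsCopulaOf (C i) (H i))
    (hG : IsCopulaOf G K)
    (h : ∀ x y, Tendsto (fun i => jointCdf (H i) x y) l (𝓝 (jointCdf K x y)))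
    (hm : ∀ j t, Tendsto (fun i => marginCdf (H i) j t) l (𝓝 (marginCdf K j t))) :
    TendstoUniformlyOn (fun i (p : ℝ × ℝ) => jointCdf (C i) p.1 p.2)
      (fun p : ℝ × ℝ => jointCdf G p.1 p.2) l (Icc 0 1 ×ˢ Icc 0 1) := by
  refine tendstoUniformlyOn_jointCdf_of_isCopula (hC.mono fun i hi => hi.1) hG.1
    fun u hu v hv => ?_
  obtain ⟨x, rfl⟩ := hK.exists_marginCdf_eq 0 hu
  obtain ⟨y, rfl⟩ := hK.exists_marginCdf_eq 1 hv
  rw [← hG.2, tendsto_iff_norm_sub_tendsto_zero]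
  -- The Lipschitz bound moves the arguments of `C i` from the margins of `K` to those of `H i`,
  -- where `C i` reproduces the distribution function of `H i`. The latter may have atoms.
  have hlim : Tendsto (fun i => |marginCdf K 0 x - marginCdf (H i) 0 x| +
      |marginCdf K 1 y - marginCdf (H i) 1 y| + |jointCdf (H i) x y - jointCdf K x y|) l
      (𝓝 0) := by
    have h0 := ((hm 0 x).const_sub (marginCdf K 0 x)).abs
    have h1 := ((hm 1 y).const_sub (marginCdf K 1 y)).abs
    have h2 := ((h x y).sub_const (jointCdf K x y)).abs
    simpa using (h0.add h1).add h2
  refine squeeze_zero' (.of_forall fun _ => norm_nonneg _) ?_ hlim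
  filter_upwards [hC, hH] with i hCi hHi
  rw [Real.norm_eq_abs]
  have h1 := hCi.1.abs_jointCdf_sub_le (Ioo_subset_Icc_self hu) (Ioo_subset_Icc_self hv)
    (marginCdf_mem_Icc (H i) 0 x) (marginCdf_mem_Icc (H i) 1 y)
  have h2 := abs_sub_le (jointCdf (C i) (marginCdf K 0 x) (marginCdf K 1 y))
    (jointCdf (C i) (marginCdf (H i) 0 x) (marginCdf (H i) 1 y)) (jointCdf K x y)
  rw [hCi.2]
  linarith

/-! ### Existence of copulas -/

/-- For `t < 1` the sublevel set is empty (only if `t = 0`) or a closed half-line; by continuity the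
distribution function equals `t` at its endpoint. -/
lemma HasContinuousMargins.measure_marginCdf_le {H : Measure Plane} [IsProbabilityMeasure H]
    (hH : HasContinuousMargins H) (j : Fin 2) {t : ℝ} (ht : t ∈ Icc (0 : ℝ) 1) :
    H {p | marginCdf H j (p j) ≤ t} = ENNReal.ofReal t := by
  rcases ht.2.eq_or_lt with rfl | ht1
  · simp [marginCdf_le_one]
  rcases ({x | marginCdf H j x ≤ t} : Set ℝ).eq_empty_or_nonempty with he | hne
  · have h0 : t = 0 := by
      by_contra h
      obtain ⟨x, hx⟩ := hH.exists_marginCdf_eq j ⟨lt_of_le_of_ne ht.1 (Ne.symm h), ht1⟩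
      exact he.subset (show x ∈ {x | marginCdf H j x ≤ t} from hx.le)
    have : {p : Plane | marginCdf H j (p j) ≤ t} = ∅ :=
      eq_empty_of_forall_notMem fun p hp => he.subset (show p j ∈ _ from hp)
    rw [this, h0, measure_empty, ENNReal.ofReal_zero]
  have hbdd : BddAbove {x | marginCdf H j x ≤ t} := by
    obtain ⟨b, hb⟩ := hH.exists_marginCdf_eq j (u := (t + 1) / 2)
      ⟨by linarith [ht.1], by linarith⟩
    refine ⟨b, fun x hx => ?_⟩
    by_contra! hlt
    have := marginCdf_mono H j hlt.le
    rw [mem_ofPred_eq] at hx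
    linarith
  have hcl : IsClosed {x | marginCdf H j x ≤ t} :=
    isClosed_le (hH.continuous_marginCdf j) continuous_const
  set s := sSup {x | marginCdf H j x ≤ t} with hs
  have hsm : marginCdf H j s ≤ t := hcl.csSup_mem hne hbdd
  have hst : marginCdf H j s = t := by
    refine le_antisymm hsm ?_
    rcases ht.1.eq_or_lt with h0 | h0
    · exact h0 ▸ marginCdf_nonneg H j s
    · obtain ⟨x, hx⟩ := hH.exists_marginCdf_eq j ⟨h0, ht1⟩
      exact hx ▸ marginCdf_mono H j (le_csSup hbdd hx.le)
  have hset : {p : Plane | marginCdf H j (p j) ≤ t} = {p | p j ≤ s} := by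
    ext p
    exact ⟨fun hp => le_csSup hbdd hp, fun hp => (marginCdf_mono H j hp).trans hsm⟩
  rw [hset, ← hst, marginCdf, ofReal_measureReal]

/-- The **probability integral transform**. -/
lemma HasContinuousMargins.map_marginCdf {H : Measure Plane} [IsProbabilityMeasure H]
    (hH : HasContinuousMargins H) (j : Fin 2) :
    H.map (fun p => marginCdf H j (p j)) = volume.restrict (Icc 0 1) := by
  have hmeas : Measurable fun p : Plane => marginCdf H j (p j) :=
    (measurable_marginCdf H j).comp (measurable_plane_apply j)
  refine Measure.ext_of_Iic _ _ fun t => ?_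
  have hset : Iic t ∩ Icc 0 1 = Icc 0 (min t 1) := by
    ext x
    simp only [mem_inter_iff, mem_Iic, mem_Icc, le_min_iff]
    tauto
  rw [Measure.map_apply hmeas measurableSet_Iic, Measure.restrict_apply measurableSet_Iic, hset,
    Real.volume_Icc, sub_zero]
  rcases lt_or_ge t 0 with h0 | h0
  · have : (fun p : Plane => marginCdf H j (p j)) ⁻¹' Iic t = ∅ :=
      eq_empty_of_forall_notMem fun p hp => (h0.trans_le (marginCdf_nonneg H j (p j))).not_ge hp
    rw [this, measure_empty, ENNReal.ofReal_of_nonpos ((min_le_left _ _).trans h0.le)]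
  rcases le_or_gt t 1 with h1 | h1
  · rw [min_eq_left h1]
    exact hH.measure_marginCdf_le j ⟨h0, h1⟩
  · have : (fun p : Plane => marginCdf H j (p j)) ⁻¹' Iic t = univ :=
      eq_univ_of_forall fun p => (marginCdf_le_one H j (p j)).trans h1.le
    rw [this, measure_univ, min_eq_right h1.le, ENNReal.ofReal_one]

lemma measurable_toPlane {Ω : Type*} [MeasurableSpace Ω] {f : Fin 2 → Ω → ℝ}
    (hf : ∀ j, Measurable (f j)) : Measurable fun ω => (WithLp.toLp 2 fun j => f j ω : Plane) :=
  (WithLp.measurable_toLp 2 _).comp (measurable_pi_iff.2 hf)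

/-- **Sklar's theorem** for continuous margins. -/
lemma HasContinuousMargins.exists_isCopulaOf {H : Measure Plane} [IsProbabilityMeasure H]
    (hH : HasContinuousMargins H) : ∃ C, IsCopulaOf C H := by
  have hmj (j : Fin 2) : Measurable fun p : Plane => marginCdf H j (p j) :=
    (measurable_marginCdf H j).comp (measurable_plane_apply j)
  have hΦ : Measurable fun p : Plane => (WithLp.toLp 2 fun j => marginCdf H j (p j) : Plane) :=
    measurable_toPlane hmj
  set C := H.map fun p : Plane => (WithLp.toLp 2 fun j => marginCdf H j (p j) : Plane) with hCdef
  have hCj (j : Fin 2) {s : Set ℝ} (hs : MeasurableSet s) :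
      C {p | p j ∈ s} = volume (s ∩ Icc 0 1) := by
    rw [← Measure.restrict_apply hs, ← hH.map_marginCdf j, Measure.map_apply (hmj j) hs, hCdef,
      Measure.map_apply hΦ (show MeasurableSet {p : Plane | p j ∈ s} from
        measurable_plane_apply j hs)]
    rfl
  refine ⟨C, ⟨Measure.isProbabilityMeasure_map hΦ.aemeasurable, fun j r => ?_,
    fun j t h0 h1 => ?_⟩, fun x y => ?_⟩
  · exact (hCj j (measurableSet_singleton r)).trans
      (measure_mono_null inter_subset_left (measure_singleton r))
  · refine (hCj j (measurableSet_Icc (a := 0) (b := t))).trans ?_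
    rw [inter_eq_left.2 (Icc_subset_Icc_right h1), Real.volume_Icc, sub_zero]
  -- The distribution function may be flat to the right of `x`, so the events are only nested; equal
  -- measures make them agree almost everywhere.
  · have hae (j : Fin 2) (x : ℝ) :
        ({p | p j ≤ x} : Set Plane) =ᵐ[H] {p | marginCdf H j (p j) ≤ marginCdf H j x} := by
      refine ae_eq_of_subset_of_measure_ge (fun p hp => marginCdf_mono H j hp) ?_
        (measurableSet_margin_le j x).nullMeasurableSet (measure_ne_top _ _)
      rw [hH.measure_marginCdf_le j (marginCdf_mem_Icc H j x), marginCdf, ofReal_measureReal]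
    rw [jointCdf, jointCdf, hCdef, map_measureReal_apply hΦ (measurableSet_quadrant _ _)]
    exact congrArg ENNReal.toReal (measure_congr ((hae 0 x).inter (hae 1 y)))

/-- The real line with the point `0` replaced by a unit interval, `v` being the position inside
that interval. -/
noncomputable def splitZero (a v : ℝ) : ℝ := if a < 0 then a else if a = 0 then v else a + 1

lemma measurable_splitZero : Measurable fun q : ℝ × ℝ => splitZero q.1 q.2 :=
  Measurable.ite (measurable_fst measurableSet_Iio) measurable_fst
    (Measurable.ite (measurable_fst (measurableSet_singleton 0)) measurable_snd
      (measurable_fst.add_const 1))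

/-- The threshold `x = 0` becomes `1`, the right end of the inserted interval, so the whole former
atom stays below it. -/
lemma splitZero_le_iff {a v : ℝ} (hv : v ∈ Icc (0 : ℝ) 1) (x : ℝ) :
    splitZero a v ≤ (if x < 0 then x else x + 1) ↔ a ≤ x := by
  obtain ⟨h0, h1⟩ := hv
  unfold splitZero
  split_ifs <;> constructor <;> intro h <;> grind

lemma eq_of_splitZero_eq {a v r : ℝ} (h : splitZero a v = r) :
    (r ≠ 0 ∧ a = r) ∨ (r - 1 ≠ 0 ∧ a = r - 1) ∨ v = r := by
  unfold splitZero at h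
  split_ifs at h <;> grind

/-- **Sklar's theorem** for distributions whose margins have no atom other than `0`. -/
lemma exists_isCopulaOf_of_atom_zero {H : Measure Plane} [IsProbabilityMeasure H]
    (hH : ∀ (j : Fin 2) (r : ℝ), r ≠ 0 → H {p : Plane | p j = r} = 0) :
    ∃ C, IsCopulaOf C H := by
  -- One uniform variable serves both coordinates; any coupling would do, as only the individual
  -- thresholds have to be preserved.
  let U : Measure ℝ := volume.restrict (Icc 0 1)
  have hU : IsProbabilityMeasure U := ⟨by simp [U]⟩
  have hmj (j : Fin 2) : Measurable fun q : Plane × ℝ => splitZero (q.1 j) q.2 :=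
    measurable_splitZero.comp
      (((measurable_plane_apply j).comp measurable_fst).prodMk measurable_snd)
  have hY : Measurable fun q : Plane × ℝ =>
      (WithLp.toLp 2 fun j => splitZero (q.1 j) q.2 : Plane) := measurable_toPlane hmj
  set K := (H.prod U).map fun q : Plane × ℝ =>
    (WithLp.toLp 2 fun j => splitZero (q.1 j) q.2 : Plane) with hKdef
  have hK : IsProbabilityMeasure K := Measure.isProbabilityMeasure_map hY.aemeasurable
  have hKm : HasContinuousMargins K := by
    intro j r
    rw [hKdef, Measure.map_apply hY (measurableSet_margin_eq j r)]
    have h1 (s : ℝ) (hs : s ≠ 0) : (H.prod U) (Prod.fst ⁻¹' {p : Plane | p j = s}) = 0 := by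
      rw [measurePreserving_fst.measure_preimage (measurableSet_margin_eq j s).nullMeasurableSet]
      exact hH j s hs
    have h2 : (H.prod U) (Prod.snd ⁻¹' {r}) = 0 := by
      rw [measurePreserving_snd.measure_preimage (measurableSet_singleton r).nullMeasurableSet]
      exact measure_mono_null (t := {r}) le_rfl (by simp [U])
    refine measure_mono_null (t := (⋃ _ : r ≠ 0, Prod.fst ⁻¹' {p : Plane | p j = r}) ∪
      ((⋃ _ : r - 1 ≠ 0, Prod.fst ⁻¹' {p : Plane | p j = r - 1}) ∪ Prod.snd ⁻¹' {r})) ?_ ?_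
    · intro q hq
      have := eq_of_splitZero_eq (show splitZero (q.1 j) q.2 = r from hq)
      simpa [mem_iUnion] using this
    · rw [measure_union_null_iff, measure_union_null_iff]
      exact ⟨measure_iUnion_null fun h => h1 _ h, measure_iUnion_null fun h => h1 _ h, h2⟩
  obtain ⟨C, hC⟩ := hKm.exists_isCopulaOf
  have hae : ∀ᵐ q ∂(H.prod U), q.2 ∈ Icc (0 : ℝ) 1 :=
    Measure.quasiMeasurePreserving_snd.ae (ae_restrict_mem measurableSet_Icc)
  have hm (j : Fin 2) (x : ℝ) : marginCdf K j (if x < 0 then x else x + 1) = marginCdf H j x := by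
    rw [marginCdf, hKdef, map_measureReal_apply hY (measurableSet_margin_le j _), marginCdf,
      ← (measurePreserving_fst (μ := H) (ν := U)).measureReal_preimage
        (measurableSet_margin_le j x).nullMeasurableSet]
    refine congrArg ENNReal.toReal (measure_congr ?_)
    filter_upwards [hae] with q hq
    exact propext (splitZero_le_iff hq x)
  refine ⟨C, hC.1, fun x y => ?_⟩
  rw [← hm 0, ← hm 1, ← hC.2, jointCdf, jointCdf, hKdef,
    map_measureReal_apply hY (measurableSet_quadrant _ _),
    ← (measurePreserving_fst (μ := H) (ν := U)).measureReal_preimage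
      (measurableSet_quadrant x y).nullMeasurableSet]
  refine congrArg ENNReal.toReal (measure_congr ?_)
  filter_upwards [hae] with q hq
  exact propext (and_congr (splitZero_le_iff hq x) (splitZero_le_iff hq y)).symm

/-! ### The compound Poisson distribution -/

section CompoundPoisson

variable {F : Measure Plane} [IsProbabilityMeasure F]

lemma isProbabilityMeasure_convPower (k : ℕ) : IsProbabilityMeasure (convPower F k) := by
  induction k with
  | zero => exact inferInstanceAs (IsProbabilityMeasure (Measure.dirac 0))
  | succ k ih => exact inferInstanceAs (IsProbabilityMeasure (Measure.conv (convPower F k) F))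

lemma charFun_convPower (k : ℕ) (t : Plane) : charFun (convPower F k) t = charFun F t ^ k := by
  induction k with
  | zero => simp [convPower]
  | succ k ih =>
    have := isProbabilityMeasure_convPower (F := F) k
    rw [convPower, charFun_conv, ih, pow_succ]

/-- Given the first `k` jumps, the last one must hit a prescribed level, which is a null event
(Fubini). -/
lemma hasContinuousMargins_convPower_succ (hF : HasContinuousMargins F) (k : ℕ) :
    HasContinuousMargins (convPower F (k + 1)) := by
  intro j r
  have := isProbabilityMeasure_convPower (F := F) k
  rw [convPower, Measure.conv, Measure.map_apply (by fun_prop) (measurableSet_margin_eq j r),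
    Measure.measure_prod_null (measurable_add (measurableSet_margin_eq j r))]
  refine .of_forall fun x => ?_
  have hset : Prod.mk x ⁻¹' ((fun q : Plane × Plane => q.1 + q.2) ⁻¹' {p | p j = r})
      = {p : Plane | p j = r - x j} := by
    ext p
    simp [eq_sub_iff_add_eq']
  exact (congrArg F hset).trans (hF j _)

lemma convPower_margin_eq_zero (hF : HasContinuousMargins F) (k : ℕ) (j : Fin 2) {r : ℝ}
    (hr : r ≠ 0) : convPower F k {p : Plane | p j = r} = 0 := by
  cases k with
  | zero =>
    rw [convPower, Measure.dirac_apply' _ (measurableSet_margin_eq j r)]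
    simp [hr.symm]
  | succ k => exact hasContinuousMargins_convPower_succ hF k j r

lemma compoundPoisson_margin_eq_zero (hF : HasContinuousMargins F) (lam : ℝ) (j : Fin 2) {r : ℝ}
    (hr : r ≠ 0) : compoundPoisson lam F {p : Plane | p j = r} = 0 := by
  rw [compoundPoisson, Measure.sum_apply_eq_zero]
  intro k
  rw [Measure.smul_apply, convPower_margin_eq_zero hF k j hr, smul_zero]

lemma hasSum_poisson_weights (lam : ℝ) :
    HasSum (fun k : ℕ => Real.exp (-lam) * (lam ^ k / (k.factorial : ℝ))) 1 := by
  have h := (NormedSpace.expSeries_div_hasSum_exp (𝔸 := ℝ) lam).mul_left (Real.exp (-lam))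
  rwa [← Real.exp_eq_exp_ℝ, ← Real.exp_add, neg_add_cancel, Real.exp_zero] at h

lemma isProbabilityMeasure_compoundPoisson {lam : ℝ} (hlam : 0 ≤ lam) :
    IsProbabilityMeasure (compoundPoisson lam F) := by
  have (k : ℕ) := isProbabilityMeasure_convPower (F := F) k
  refine ⟨?_⟩
  rw [compoundPoisson, Measure.sum_apply _ MeasurableSet.univ]
  simp only [Measure.smul_apply, measure_univ, smul_eq_mul, mul_one]
  rw [← ENNReal.ofReal_tsum_of_nonneg (fun k => by positivity) (hasSum_poisson_weights lam).summable,
    (hasSum_poisson_weights lam).tsum_eq, ENNReal.ofReal_one]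

lemma charFun_compoundPoisson {lam : ℝ} (hlam : 0 ≤ lam) (t : Plane) :
    charFun (compoundPoisson lam F) t = Complex.exp (lam * (charFun F t - 1)) := by
  have (k : ℕ) := isProbabilityMeasure_convPower (F := F) k
  have := isProbabilityMeasure_compoundPoisson (F := F) hlam
  have hint : Integrable (fun x : Plane => Complex.exp (inner ℝ x t * Complex.I))
      (compoundPoisson lam F) := by
    refine Integrable.of_bound (by fun_prop) 1 (.of_forall fun x => ?_)
    rw [Complex.norm_exp_ofReal_mul_I]
  have h1 := hasSum_integral_measure hint
  have h2 : HasSum (fun k : ℕ => Complex.exp (-lam) * ((lam * charFun F t) ^ k / k.factorial))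
      (Complex.exp (-lam) * Complex.exp (lam * charFun F t)) := by
    have h := (NormedSpace.expSeries_div_hasSum_exp (𝔸 := ℂ) (lam * charFun F t)).mul_left
      (Complex.exp (-lam))
    rwa [← Complex.exp_eq_exp_ℂ] at h
  rw [charFun_apply]
  refine (h1.unique (a₂ := Complex.exp (-lam) * Complex.exp (lam * charFun F t)) ?_).trans ?_
  · convert! h2 using 2 with k
    rw [integral_smul_measure, ← charFun_apply, charFun_convPower,
      ENNReal.toReal_ofReal (by positivity), Complex.real_smul]
    push_cast
    rw [mul_pow]
    ring
  · rw [← Complex.exp_add]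
    ring_nf

end CompoundPoisson

/-! ### The normal limit of the standardised compound Poisson distribution -/

/-- Being valid for every real `a`, this provides the dominating function: Taylor's bound for `|a| ≤
1`, and `2 + |a| ≤ 3a²` otherwise. -/
lemma norm_cexp_mul_I_sub_one_sub_le (a : ℝ) :
    ‖Complex.exp (a * Complex.I) - 1 - a * Complex.I‖ ≤ 3 * a ^ 2 := by
  have hn : ‖(a * Complex.I : ℂ)‖ = |a| := by simp
  rcases le_or_gt |a| 1 with h | h
  · refine (Complex.norm_exp_sub_one_sub_id_le (hn.trans_le h)).trans ?_
    rw [hn, sq_abs]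
    nlinarith [sq_nonneg a]
  · refine (norm_sub_le _ _).trans ((add_le_add_left (norm_sub_le _ _) _).trans ?_)
    rw [hn, Complex.norm_exp_ofReal_mul_I, norm_one, ← sq_abs]
    nlinarith

lemma norm_cexp_sub_one_sub_sub_sq_le {z : ℂ} (hz : ‖z‖ ≤ 1) :
    ‖Complex.exp z - 1 - z - z ^ 2 / 2‖ ≤ ‖z‖ ^ 3 := by
  have h := Complex.exp_bound hz (n := 3) (by norm_num)
  have hs : Complex.exp z - ∑ m ∈ Finset.range 3, z ^ m / m.factorial
      = Complex.exp z - 1 - z - z ^ 2 / 2 := by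
    simp [Finset.sum_range_succ, Nat.factorial]
    ring
  rw [hs] at h
  refine h.trans (mul_le_of_le_one_right (by positivity) ?_)
  norm_num [Nat.factorial]

lemma tendsto_mul_cexp_sub_one_sub (a : ℝ) :
    Tendsto (fun lam : ℝ => (lam : ℂ) * (Complex.exp (((√lam)⁻¹ * a : ℝ) * Complex.I) - 1 -
      ((√lam)⁻¹ * a : ℝ) * Complex.I)) atTop (𝓝 (-(a ^ 2 / 2 : ℝ))) := by
  have hc : Tendsto (fun lam : ℝ => (√lam)⁻¹) atTop (𝓝 0) :=
    tendsto_inv_atTop_zero.comp Real.tendsto_sqrt_atTop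
  rw [tendsto_iff_norm_sub_tendsto_zero]
  refine squeeze_zero' (.of_forall fun _ => norm_nonneg _) ?_
    (show Tendsto (fun lam : ℝ => (√lam)⁻¹ * |a| ^ 3) atTop (𝓝 0) by simpa using hc.mul_const _)
  have hsmall : ∀ᶠ lam : ℝ in atTop, (√lam)⁻¹ * |a| < 1 := by
    have : Tendsto (fun lam : ℝ => (√lam)⁻¹ * |a|) atTop (𝓝 0) := by simpa using hc.mul_const _
    exact this.eventually (gt_mem_nhds one_pos)
  filter_upwards [hsmall, eventually_gt_atTop 0] with lam h1 h0
  have hs : 0 < √lam := Real.sqrt_pos.2 h0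
  have hsq : √lam ^ 2 = lam := Real.sq_sqrt h0.le
  set z : ℂ := ((√lam)⁻¹ * a : ℝ) * Complex.I with hz
  have hzn : ‖z‖ = (√lam)⁻¹ * |a| := by
    rw [hz, norm_mul, Complex.norm_I, mul_one, Complex.norm_real, norm_mul, Real.norm_eq_abs,
      Real.norm_eq_abs, abs_of_pos (inv_pos.2 hs)]
  have hz2 : (lam : ℂ) * (z ^ 2 / 2) = -(a ^ 2 / 2 : ℝ) := by
    rw [hz, mul_pow, Complex.I_sq]
    have : lam * ((√lam)⁻¹ * a) ^ 2 = a ^ 2 := by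
      rw [mul_pow, inv_pow, hsq]
      field_simp
    rw [← this]
    push_cast
    ring
  rw [← hz2, ← mul_sub, norm_mul, Complex.norm_real, Real.norm_of_nonneg h0.le]
  refine (mul_le_mul_of_nonneg_left (norm_cexp_sub_one_sub_sub_sq_le (hzn.trans_le h1.le))
    h0.le).trans (le_of_eq ?_)
  -- The remainder is `lam (|a| / √lam)³ = |a|³ / √lam`.
  rw [hzn]
  nth_rewrite 1 [← hsq]
  field_simp

section Limit

variable {F : Measure Plane}

lemma integrable_apply_sq (hF2 : Integrable (fun p : Plane => (p 0) ^ 2 + (p 1) ^ 2) F)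
    (j : Fin 2) : Integrable (fun p : Plane => (p j) ^ 2) F := by
  refine hF2.mono' (by fun_prop) (.of_forall fun p => ?_)
  rw [Real.norm_of_nonneg (sq_nonneg _)]
  fin_cases j
  · simpa using sq_nonneg (p 1)
  · simpa using sq_nonneg (p 0)

lemma memLp_apply (hF2 : Integrable (fun p : Plane => (p 0) ^ 2 + (p 1) ^ 2) F)
    (j : Fin 2) : MemLp (fun p : Plane => p j) 2 F :=
  (memLp_two_iff_integrable_sq (by fun_prop)).2 (integrable_apply_sq hF2 j)

lemma inner_plane (x t : Plane) : inner ℝ x t = x 0 * t 0 + x 1 * t 1 := by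
  simp [PiLp.inner_apply, mul_comm]

lemma memLp_inner (hF2 : Integrable (fun p : Plane => (p 0) ^ 2 + (p 1) ^ 2) F) (t : Plane) :
    MemLp (fun p : Plane => inner ℝ p t) 2 F := by
  simp only [inner_plane]
  exact ((memLp_apply hF2 0).mul_const _).add ((memLp_apply hF2 1).mul_const _)

lemma integral_inner_sq (hF2 : Integrable (fun p : Plane => (p 0) ^ 2 + (p 1) ^ 2) F)
    (t : Plane) : ∫ p, (inner ℝ p t) ^ 2 ∂F = t ⬝ᵥ (secondMomentMatrix F).mulVec t := by
  have h0 := integrable_apply_sq hF2 0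
  have h1 := integrable_apply_sq hF2 1
  have h01 : Integrable (fun p : Plane => p 0 * p 1) F :=
    (memLp_apply hF2 0).integrable_mul (memLp_apply hF2 1)
  have hexp (p : Plane) : (inner ℝ p t) ^ 2
      = (t 0 ^ 2 * p 0 ^ 2 + 2 * (t 0 * t 1) * (p 0 * p 1)) + t 1 ^ 2 * p 1 ^ 2 := by
    rw [inner_plane]
    ring
  have hadd : Integrable
      (fun p : Plane => t 0 ^ 2 * p 0 ^ 2 + 2 * (t 0 * t 1) * (p 0 * p 1)) F :=
    (h0.const_mul _).add (h01.const_mul _)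
  simp only [hexp]
  rw [integral_add hadd (h1.const_mul _),
    integral_add (h0.const_mul _) (h01.const_mul _), integral_const_mul, integral_const_mul,
    integral_const_mul]
  simp [secondMomentMatrix, Matrix.mulVec, dotProduct, Fin.sum_univ_two]
  ring

lemma posSemidef_secondMomentMatrix
    (hF2 : Integrable (fun p : Plane => (p 0) ^ 2 + (p 1) ^ 2) F) :
    (secondMomentMatrix F).PosSemidef := by
  refine Matrix.PosSemidef.of_dotProduct_mulVec_nonneg ?_ fun x => ?_
  · ext i j
    fin_cases i <;> fin_cases j <;> simp [secondMomentMatrix]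
  · have h := integral_inner_sq hF2 (WithLp.toLp 2 x)
    rw [star_trivial]
    exact h ▸ integral_nonneg fun p => sq_nonneg _

variable [IsProbabilityMeasure F]

variable (F) in
/-- The mean vector of `F`. -/
noncomputable def meanVector : Plane := WithLp.toLp 2 fun j => ∫ p, p j ∂F

lemma integral_inner_eq_inner_meanVector (hF2 : Integrable (fun p : Plane => (p 0) ^ 2 + (p 1) ^ 2) F) (t : Plane) :
    ∫ p, inner ℝ p t ∂F = inner ℝ (meanVector F) t := by
  have h (j : Fin 2) := (memLp_apply hF2 j).integrable one_le_two
  simp only [inner_plane]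
  rw [integral_add ((h 0).mul_const _) ((h 1).mul_const _), integral_mul_const,
    integral_mul_const]
  rfl

variable (F) in
/-- The compound Poisson distribution, centred at its mean and scaled by `1 / √lam`. -/
noncomputable def standardizedCompoundPoisson (lam : ℝ) : Measure Plane :=
  -- The mean `lam • meanVector F` becomes `√lam • meanVector F` after the scaling.
  ((compoundPoisson lam F).map ((√lam)⁻¹ • ·)).map (· + -(√lam • meanVector F))

lemma isProbabilityMeasure_standardizedCompoundPoisson {lam : ℝ} (hlam : 0 ≤ lam) :
    IsProbabilityMeasure (standardizedCompoundPoisson F lam) := by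
  have := isProbabilityMeasure_compoundPoisson (F := F) hlam
  have := Measure.isProbabilityMeasure_map (μ := compoundPoisson lam F)
    (f := ((√lam)⁻¹ • ·)) (by fun_prop)
  exact Measure.isProbabilityMeasure_map (by fun_prop)

/-- The centring supplies exactly the linear Taylor term, which can be moved under the integral over
`F`. -/
lemma charFun_standardizedCompoundPoisson
    (hF2 : Integrable (fun p : Plane => (p 0) ^ 2 + (p 1) ^ 2) F) {lam : ℝ} (hlam : 0 < lam)
    (t : Plane) : charFun (standardizedCompoundPoisson F lam) t =
      Complex.exp (∫ p, (lam : ℂ) * (Complex.exp (((√lam)⁻¹ * inner ℝ p t : ℝ) * Complex.I) - 1 -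
        ((√lam)⁻¹ * inner ℝ p t : ℝ) * Complex.I) ∂F) := by
  have hs : 0 < √lam := Real.sqrt_pos.2 hlam
  have hint : Integrable (fun p : Plane => inner ℝ p t) F :=
    (memLp_inner hF2 t).integrable one_le_two
  have hexp : Integrable
      (fun p : Plane => Complex.exp (((√lam)⁻¹ * inner ℝ p t : ℝ) * Complex.I)) F := by
    refine Integrable.of_bound (by fun_prop) 1 (.of_forall fun x => ?_)
    rw [Complex.norm_exp_ofReal_mul_I]
  have hlin : Integrable (fun p : Plane => (((√lam)⁻¹ * inner ℝ p t : ℝ) : ℂ) * Complex.I) F :=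
    (hint.const_mul _).ofReal.mul_const _
  have hφ : charFun F ((√lam)⁻¹ • t) =
      ∫ p : Plane, Complex.exp (((√lam)⁻¹ * inner ℝ p t : ℝ) * Complex.I) ∂F := by
    simp only [charFun_apply, inner_smul_right]
  have hsub : Integrable
      (fun p : Plane => Complex.exp (((√lam)⁻¹ * inner ℝ p t : ℝ) * Complex.I) - 1) F :=
    hexp.sub (integrable_const _)
  rw [standardizedCompoundPoisson, charFun_map_add_const, charFun_map_smul,
    charFun_compoundPoisson hlam.le, ← Complex.exp_add, integral_const_mul,
    integral_sub hsub hlin, integral_sub hexp (integrable_const _),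
    integral_mul_const, integral_complex_ofReal, integral_const_mul, integral_inner_eq_inner_meanVector hF2, hφ]
  generalize ∫ p : Plane, Complex.exp (((√lam)⁻¹ * inner ℝ p t : ℝ) * Complex.I) ∂F = φ
  simp only [integral_const, probReal_univ, one_smul, inner_neg_left,
    real_inner_smul_left]
  congr 1
  have h2 : ((lam : ℝ) : ℂ) = (√lam : ℂ) ^ 2 := by
    rw [← Complex.ofReal_pow, Real.sq_sqrt hlam.le]
  have h3 : (√lam : ℂ) ≠ 0 := by exact_mod_cast hs.ne'
  rw [h2]
  push_cast
  field_simp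
  ring

lemma tendsto_charFun_standardizedCompoundPoisson
    (hF2 : Integrable (fun p : Plane => (p 0) ^ 2 + (p 1) ^ 2) F) (t : Plane) :
    Tendsto (fun lam => charFun (standardizedCompoundPoisson F lam) t) atTop
      (𝓝 (Complex.exp (-((∫ p, (inner ℝ p t) ^ 2 ∂F) / 2 : ℝ)))) := by
  have hsq : Integrable (fun p : Plane => (inner ℝ p t) ^ 2) F := (memLp_inner hF2 t).integrable_sq
  have hlim : Tendsto (fun lam : ℝ => ∫ p, (lam : ℂ) *
      (Complex.exp (((√lam)⁻¹ * inner ℝ p t : ℝ) * Complex.I) - 1 -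
        ((√lam)⁻¹ * inner ℝ p t : ℝ) * Complex.I) ∂F) atTop
      (𝓝 (∫ p, -(((inner ℝ p t) ^ 2 / 2 : ℝ) : ℂ) ∂F)) := by
    refine tendsto_integral_filter_of_dominated_convergence
      (fun p : Plane => 3 * (inner ℝ p t) ^ 2) (.of_forall fun lam => by fun_prop) ?_
      (hsq.const_mul 3) (.of_forall fun p => tendsto_mul_cexp_sub_one_sub _)
    filter_upwards [eventually_gt_atTop 0] with lam hlam
    refine .of_forall fun p => ?_
    rw [norm_mul, Complex.norm_real, Real.norm_of_nonneg hlam.le]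
    refine (mul_le_mul_of_nonneg_left (norm_cexp_mul_I_sub_one_sub_le _) hlam.le).trans
      (le_of_eq ?_)
    rw [mul_pow, inv_pow, Real.sq_sqrt hlam.le]
    field_simp
  rw [integral_neg, integral_complex_ofReal, integral_div] at hlim
  refine ((Complex.continuous_exp.tendsto _).comp hlim).congr' ?_
  filter_upwards [eventually_gt_atTop 0] with lam hlam
  exact (charFun_standardizedCompoundPoisson hF2 hlam t).symm

lemma secondMomentMatrix_diag_pos (hF : HasContinuousMargins F)
    (hF2 : Integrable (fun p : Plane => (p 0) ^ 2 + (p 1) ^ 2) F) (j : Fin 2) :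
    0 < secondMomentMatrix F j j := by
  have hpos : 0 < ∫ p : Plane, (p j) ^ 2 ∂F := by
    rw [integral_pos_iff_support_of_nonneg (fun p => sq_nonneg _) (integrable_apply_sq hF2 j)]
    have hsupp : Function.support (fun p : Plane => (p j) ^ 2) = {p : Plane | p j = 0}ᶜ := by
      ext p
      simp
    rw [hsupp, prob_compl_eq_one_sub (measurableSet_margin_eq j 0), hF j 0]
    simp
  fin_cases j <;> simpa [secondMomentMatrix] using hpos

/-- Only the one-dimensional variances matter, so a singular `S` is allowed. -/
lemma hasContinuousMargins_multivariateGaussian (m : Plane) {S : Matrix (Fin 2) (Fin 2) ℝ}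
    (hS : S.PosSemidef) (hpos : ∀ j, 0 < S j j) :
    HasContinuousMargins (multivariateGaussian m S) := by
  intro j r
  have hm := measurePreserving_eval_multivariateGaussian (μ := m) hS (i := j)
  have := nullSingletonClass_gaussianReal (μ := m j) (v := (S j j).toNNReal) (by simpa using hpos j)
  exact (hm.measure_preimage (measurableSet_singleton r).nullMeasurableSet).trans
    (measure_singleton r)

lemma tendsto_standardizedCompoundPoisson_apply
    (hF2 : Integrable (fun p : Plane => (p 0) ^ 2 + (p 1) ^ 2) F) {s : Set Plane}
    (hs : multivariateGaussian 0 (secondMomentMatrix F) (frontier s) = 0) :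
    Tendsto (fun lam => (standardizedCompoundPoisson F lam).real s) atTop
      (𝓝 ((multivariateGaussian 0 (secondMomentMatrix F)).real s)) := by
  have hS := posSemidef_secondMomentMatrix hF2
  rw [tendsto_iff_seq_tendsto]
  intro u hu
  -- The absolute value makes every term a probability measure; it is eventually redundant.
  let P : ℕ → ProbabilityMeasure Plane := fun n => ⟨standardizedCompoundPoisson F |u n|,
    isProbabilityMeasure_standardizedCompoundPoisson (abs_nonneg _)⟩
  let N : ProbabilityMeasure Plane :=
    ⟨multivariateGaussian 0 (secondMomentMatrix F), inferInstance⟩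
  have hP : Tendsto P atTop (𝓝 N) := by
    refine ProbabilityMeasure.tendsto_of_tendsto_charFun fun t => ?_
    have hN : charFun (N : Measure Plane) t
        = Complex.exp (-((∫ p, (inner ℝ p t) ^ 2 ∂F) / 2 : ℝ)) := by
      refine (charFun_multivariateGaussian hS t).trans ?_
      rw [integral_inner_sq hF2]
      simp
    rw [hN]
    exact (tendsto_charFun_standardizedCompoundPoisson hF2 t).comp
      (tendsto_abs_atTop_atTop.comp hu)
  have h := (ENNReal.tendsto_toReal (measure_ne_top _ _)).comp
    (ProbabilityMeasure.tendsto_measure_of_null_frontier_of_tendsto' hP hs)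
  refine h.congr' ?_
  filter_upwards [hu.eventually_ge_atTop 0] with n hn
  simp only [Function.comp_apply, P, ProbabilityMeasure.coe_mk, abs_of_nonneg hn]
  rfl

end Limit

lemma standardizedCompoundPoisson_real {F : Measure Plane} {lam : ℝ} {s : Set Plane}
    (hs : MeasurableSet s) : (standardizedCompoundPoisson F lam).real s =
      (compoundPoisson lam F).real {p | (√lam)⁻¹ • p + -(√lam • meanVector F) ∈ s} := by
  rw [standardizedCompoundPoisson, Measure.map_map (by fun_prop) (by fun_prop),
    map_measureReal_apply (by fun_prop) hs]
  rfl

/-- The standardised compound Poisson distribution has the same copulas. -/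
lemma IsCopulaOf.standardizedCompoundPoisson {F C : Measure Plane} {lam : ℝ} (hlam : 0 < lam)
    (hC : IsCopulaOf C (compoundPoisson lam F)) :
    IsCopulaOf C (standardizedCompoundPoisson F lam) := by
  have hs : 0 < √lam := Real.sqrt_pos.2 hlam
  have hle (j : Fin 2) (p : Plane) (x : ℝ) :
      ((√lam)⁻¹ • p + -(√lam • meanVector F)) j ≤ x ↔ p j ≤ √lam * (x + √lam * meanVector F j) := by
    simp only [PiLp.add_apply, PiLp.smul_apply, PiLp.neg_apply, smul_eq_mul]
    rw [add_neg_le_iff_le_add, inv_mul_le_iff₀ hs]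
  have hm (j : Fin 2) (x : ℝ) : marginCdf (_root_.standardizedCompoundPoisson F lam) j x =
      marginCdf (compoundPoisson lam F) j (√lam * (x + √lam * meanVector F j)) := by
    rw [marginCdf, standardizedCompoundPoisson_real (measurableSet_margin_le j x), marginCdf]
    exact congrArg _ (ext fun p => hle j p x)
  refine ⟨hC.1, fun x y => ?_⟩
  rw [hm, hm, ← hC.2, jointCdf, standardizedCompoundPoisson_real (measurableSet_quadrant x y),
    jointCdf]
  exact congrArg _ (ext fun p => and_congr (hle 0 p x) (hle 1 p y))

lemma HasContinuousMargins.frontier_margin_le {H : Measure Plane} (hH : HasContinuousMargins H)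
    (j : Fin 2) (t : ℝ) : H (frontier {p : Plane | p j ≤ t}) = 0 :=
  measure_mono_null (frontier_le_subset_eq (by fun_prop) continuous_const) (hH j t)

lemma HasContinuousMargins.frontier_quadrant {H : Measure Plane} (hH : HasContinuousMargins H)
    (x y : ℝ) : H (frontier {p : Plane | p 0 ≤ x ∧ p 1 ≤ y}) = 0 :=
  measure_mono_null ((frontier_inter_subset {p : Plane | p 0 ≤ x} {p : Plane | p 1 ≤ y}).trans
      (union_subset_union inter_subset_left inter_subset_right))
    (measure_union_null (hH.frontier_margin_le 0 x) (hH.frontier_margin_le 1 y))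

theorem theorem3p5 (F : Measure Plane) [IsProbabilityMeasure F]
    (hF : HasContinuousMargins F)
    (hF2 : Integrable (fun p : Plane => (p 0) ^ 2 + (p 1) ^ 2) F) :
    (secondMomentMatrix F).PosSemidef ∧
    HasContinuousMargins (multivariateGaussian 0 (secondMomentMatrix F)) ∧
    (∀ lam : ℝ, 0 < lam → ∃ C : Measure Plane, IsCopulaOf C (compoundPoisson lam F)) ∧
    ∃ G : Measure Plane,
      IsCopulaOf G (multivariateGaussian 0 (secondMomentMatrix F)) ∧
      (∀ G' : Measure Plane,
        IsCopulaOf G' (multivariateGaussian 0 (secondMomentMatrix F)) → G' = G) ∧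
      ∀ C : ℝ → Measure Plane,
        (∀ lam : ℝ, 0 < lam → IsCopulaOf (C lam) (compoundPoisson lam F)) →
        TendstoUniformlyOn (fun (lam : ℝ) (p : ℝ × ℝ) => jointCdf (C lam) p.1 p.2)
          (fun p : ℝ × ℝ => jointCdf G p.1 p.2) atTop (Icc 0 1 ×ˢ Icc 0 1) := by
  have hS := posSemidef_secondMomentMatrix hF2
  have hN := hasContinuousMargins_multivariateGaussian 0 hS (secondMomentMatrix_diag_pos hF hF2)
  obtain ⟨G, hG⟩ := hN.exists_isCopulaOf
  refine ⟨hS, hN, fun lam hlam => ?_, G, hG, fun G' hG' => hG'.unique hN hG, fun C hC => ?_⟩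
  · have := isProbabilityMeasure_compoundPoisson (F := F) hlam.le
    exact exists_isCopulaOf_of_atom_zero fun j r hr => compoundPoisson_margin_eq_zero hF lam j hr
  · refine tendstoUniformlyOn_copula (H := standardizedCompoundPoisson F) hN ?_ ?_ hG
      (fun x y => tendsto_standardizedCompoundPoisson_apply hF2 (hN.frontier_quadrant x y))
      (fun j t => tendsto_standardizedCompoundPoisson_apply hF2 (hN.frontier_margin_le j t))
    · filter_upwards [eventually_ge_atTop 0] with lam hlam
      exact isProbabilityMeasure_standardizedCompoundPoisson hlam
    · filter_upwards [eventually_gt_atTop 0] with lam hlam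
      exact (hC lam hlam).standardizedCompoundPoisson hlam
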